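/- Conventions. C*-algebras and *-homomorphisms are unital, and $A_1$ denotes the closed unit ball of $A$. A term is a noncommutative *-polynomial with complex coefficients (constant terms allowed) in finitely many variables. Formulas are built from the atomic formulas $\|t\|$ ($t$ a term) by continuous connectives $f\colon[0,\infty)^2\to[0,\infty)$ and by the quantifiers $\inf_{\|x\|\le k}$ and $\sup_{\|x\|\le k}$ ($k\in\mathbb N$); a formula without quantifiers is called quantifier-free. A formula $\psi(x_1,\dots,x_k)$ is stable if for every $\varepsilon>0$ there is $\delta>0$ such that for every C*-algebra $B$ and $\bar a\in B^k$ with $\psi(\bar a)^B<\delta$ there is $\bar b\in B^k$ with $\|a_i-b_i\|<\varepsilon$ for all $i$ and $\psi(\bar b)^B=0$. It defines a tuple $\bar g\in C^k$ if for every C*-algebra $B$ the zero-set of $\psi$ in $B^k$ is the set of all tuples $(\Phi(g_1),\dots,\Phi(g_k))$, where $\Phi\colon C\to B$ ranges over the injective *-homomorphisms. The type of $\bar a\in (A_1)^m$ is the set of all conditions $\phi\le r$, $\phi\ge r$ ($\phi$ an $m$-ary formula, $r\ge 0$) satisfied by $\bar a$ in $A$. A type realized in $A$ is principal if in every C*-algebra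 $M$ elementarily equivalent to $A$ (i.e., every sentence has the same value in $A$ and in $M$) the set $D\subseteq (M_1)^m$ of its realizations is nonempty and definable, i.e., $D$ is closed and the function $\bar x\mapsto \operatorname{dist}(\bar x,D)$ (for the max metric) is on $(M_1)^m$ a uniform limit of $m$-ary formulas. $A$ is an atomic model if for every $m$ the type of every $\bar a\in (A_1)^m$ is principal. Proposition. Let $A$ be a separable unital C*-algebra which is the direct limit of a sequence $A_0\to A_1\to A_2\to\cdots$ of unital C*-algebras with injective unital connecting maps (here $A_n$ denotes the $n$-th algebra of the sequence). Suppose that for every $n$ (i) $A_n$ is generated, as a C*-algebra, by a finite tuple that is defined by a stable quantifier-free formula, and (ii) any two unital copies of $A_n$ in $A$ are conjugate: for all injective unital *-homomorphisms $\Phi,\Psi\colon A_n\to A$ there is an automorphism $\sigma$ of $A$ with $\sigma\circ\Phi=\Psi$. Then $A$ is an atomic model. -/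

import Mathlib

open scoped NNReal

universe u

namespace CStarLogic

/-- Terms in the variables `x₀, …, x₍ₙ₋₁₎`: noncommutative *-polynomials with complex coefficients.
The letter `Sum.inl i` stands for `xᵢ` and `Sum.inr i` for `xᵢ*`. -/
abbrev Term (n : ℕ) : Type := FreeAlgebra ℂ (Fin n ⊕ Fin n)

/-- The value of a *-polynomial at a tuple. -/
noncomputable def Term.eval {A : Type u} [CStarAlgebra A] {n : ℕ} (t : Term n)
    (a : Fin n → A) : A :=
  FreeAlgebra.lift ℂ (Sum.elim a (fun i => star (a i))) t

/-- Formulas of the logic of metric structures for unital C*-algebras with free variables among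
`x₀, …, x₍ₙ₋₁₎`. The quantifiers bind the last variable, which ranges over the ball of
radius `k`. -/
inductive Formula : ℕ → Type
  | norm {n : ℕ} (t : Term n) : Formula n
  | conn {n : ℕ} (f : C(ℝ≥0 × ℝ≥0, ℝ≥0)) (φ ψ : Formula n) : Formula n
  | inf {n : ℕ} (k : ℕ) (φ : Formula (n + 1)) : Formula n
  | sup {n : ℕ} (k : ℕ) (φ : Formula (n + 1)) : Formula n

/-- The value `φ(a)^A` of a formula at a tuple of a unital C*-algebra. (The suprema are bounded,
see `Formula.eval_bounded`.) -/
noncomputable def Formula.eval {A : Type u} [CStarAlgebra A] :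
    {n : ℕ} → Formula n → (Fin n → A) → ℝ≥0
  | _, .norm t, a => ‖t.eval a‖₊
  | _, .conn f φ ψ, a => f (φ.eval a, ψ.eval a)
  | _, .inf k φ, a => ⨅ x : {x : A // ‖x‖ ≤ k}, φ.eval (Fin.snoc a x.1 : Fin (_ + 1) → A)
  | _, .sup k φ, a => ⨆ x : {x : A // ‖x‖ ≤ k}, φ.eval (Fin.snoc a x.1 : Fin (_ + 1) → A)

/-- Quantifier-free formulas. -/
def Formula.IsQuantifierFree : {n : ℕ} → Formula n → Prop
  | _, .norm _ => True
  | _, .conn _ φ ψ => φ.IsQuantifierFree ∧ ψ.IsQuantifierFree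
  | _, .inf _ _ => False
  | _, .sup _ _ => False

theorem Term.eval_bounded {A : Type u} [CStarAlgebra A] {n : ℕ} (t : Term n) (R : ℝ) :
    ∃ C : ℝ, ∀ a : Fin n → A, (∀ i, ‖a i‖ ≤ R) → ‖t.eval a‖ ≤ C := by
  unfold Term.eval
  induction t using FreeAlgebra.induction with
  | grade0 r => exact ⟨‖algebraMap ℂ A r‖, fun a _ => by simp⟩
  | grade1 x =>
    refine ⟨R, fun a ha => ?_⟩
    rcases x with i | i <;> simpa using ha i
  | mul s t hs ht =>
    obtain ⟨C, hC⟩ := hs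
    obtain ⟨D, hD⟩ := ht
    refine ⟨C * D, fun a ha => ?_⟩
    rw [map_mul]
    exact (norm_mul_le _ _).trans (mul_le_mul (hC a ha) (hD a ha) (norm_nonneg _)
      ((norm_nonneg _).trans (hC a ha)))
  | add s t hs ht =>
    obtain ⟨C, hC⟩ := hs
    obtain ⟨D, hD⟩ := ht
    refine ⟨C + D, fun a ha => ?_⟩
    rw [map_add]
    exact (norm_add_le _ _).trans (add_le_add (hC a ha) (hD a ha))

/-- Formulas are bounded on bounded sets; in particular `Formula.sup` is a true supremum. -/
theorem Formula.eval_bounded {A : Type u} [CStarAlgebra A] {n : ℕ} (φ : Formula n) (R : ℝ) :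
    ∃ C : ℝ≥0, ∀ a : Fin n → A, (∀ i, ‖a i‖ ≤ R) → φ.eval a ≤ C := by
  have snoc_le : ∀ {n k : ℕ} {R : ℝ} {a : Fin n → A} (x : {x : A // ‖x‖ ≤ k}),
      (∀ i, ‖a i‖ ≤ R) → ∀ i, ‖(Fin.snoc a x.1 : Fin (n + 1) → A) i‖ ≤ max R k := by
    intro n k R a x ha i
    refine Fin.lastCases ?_ (fun j => ?_) i
    · simpa using Or.inr x.2
    · simpa using Or.inl (ha j)
  induction φ generalizing R with
  | norm t =>
    obtain ⟨C, hC⟩ := t.eval_bounded (A := A) R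
    exact ⟨C.toNNReal, fun a ha => NNReal.le_toNNReal_of_coe_le (hC a ha)⟩
  | conn f φ ψ hφ hψ =>
    obtain ⟨C, hC⟩ := hφ R
    obtain ⟨D, hD⟩ := hψ R
    obtain ⟨E, hE⟩ := ((isCompact_Icc (a := ((0, 0) : ℝ≥0 × ℝ≥0)) (b := (C, D))).image
      f.continuous).bddAbove
    exact ⟨E, fun a ha => hE ⟨_, ⟨⟨zero_le, zero_le⟩, hC a ha, hD a ha⟩, rfl⟩⟩
  | inf k φ h =>
    obtain ⟨C, hC⟩ := h (max R k)
    refine ⟨C, fun a ha => ?_⟩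
    exact (ciInf_le (OrderBot.bddBelow _) ⟨0, by simp⟩).trans (hC _ (snoc_le _ ha))
  | sup k φ h =>
    obtain ⟨C, hC⟩ := h (max R k)
    refine ⟨C, fun a ha => ?_⟩
    have : Nonempty {x : A // ‖x‖ ≤ k} := ⟨⟨0, by simp⟩⟩
    exact ciSup_le fun x => hC _ (snoc_le x ha)

/-- `ψ` is stable: in every unital C*-algebra, uniformly, approximate zeros of `ψ` are close to
zeros of `ψ`. -/
def Formula.IsStable {n : ℕ} (ψ : Formula n) : Prop :=
  ∀ ε : ℝ, 0 < ε → ∃ δ : ℝ, 0 < δ ∧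
    ∀ (B : Type u) [CStarAlgebra B] (a : Fin n → B), (ψ.eval a : ℝ) < δ →
      ∃ b : Fin n → B, (∀ i, ‖a i - b i‖ < ε) ∧ ψ.eval b = 0

/-- `ψ` defines the tuple `g` of elements of `C`: in every unital C*-algebra `B`, the zero-set of
`ψ` is the set of tuples that correspond to `g` in some unital copy of `C` in `B`
(a unital copy being given by an injective unital *-homomorphism). -/
def Formula.Defines {C : Type u} [CStarAlgebra C] {k : ℕ} (ψ : Formula k) (g : Fin k → C) : Prop :=
  ∀ (B : Type u) [CStarAlgebra B] (b : Fin k → B),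
    ψ.eval b = 0 ↔ ∃ Φ : C →⋆ₐ[ℂ] B, Function.Injective Φ ∧ ∀ i, Φ (g i) = b i

/-- `C` is a finitely generated C*-algebra whose generators are defined by a stable
quantifier-free formula. -/
def HasStableQFGenerators (C : Type u) [CStarAlgebra C] : Prop :=
  ∃ (k : ℕ) (g : Fin k → C) (ψ : Formula k),
    Dense (StarAlgebra.adjoin ℂ (Set.range g) : Set C) ∧
    ψ.IsQuantifierFree ∧ Formula.IsStable.{u} ψ ∧ ψ.Defines g

/-- Any two unital copies of `C` in `A` are conjugate: any two unital embeddings of `C` into `A`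
differ by an automorphism of `A`. -/
def UnitalCopiesConjugate (C A : Type u) [CStarAlgebra C] [CStarAlgebra A] : Prop :=
  ∀ Φ Ψ : C →⋆ₐ[ℂ] A, Function.Injective Φ → Function.Injective Ψ →
    ∃ σ : A ≃⋆ₐ[ℂ] A, ∀ x, σ (Φ x) = Ψ x

/-- `A`, with the maps `ι n`, is the C*-algebraic direct limit of the sequence
`C 0 → C 1 → C 2 → ⋯` with connecting maps `j n`; all maps are unital embeddings. -/
structure IsDirectLimit {A : Type u} [CStarAlgebra A] (C : ℕ → Type u) [∀ n, CStarAlgebra (C n)]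
    (j : ∀ n, C n →⋆ₐ[ℂ] C (n + 1)) (ι : ∀ n, C n →⋆ₐ[ℂ] A) : Prop where
  conn_injective : ∀ n, Function.Injective (j n)
  injective : ∀ n, Function.Injective (ι n)
  compatible : ∀ n x, ι (n + 1) (j n x) = ι n x
  dense : Dense (⋃ n, Set.range (ι n))

/-- The `n`-ary conditions `φ ≤ r` and `φ ≥ r`, with `r ≥ 0`. -/
inductive Condition (n : ℕ) : Type
  | le (φ : Formula n) (r : ℝ≥0) : Condition n
  | ge (φ : Formula n) (r : ℝ≥0) : Condition n

/-- A tuple satisfies a condition. -/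
def Condition.Sat {A : Type u} [CStarAlgebra A] {n : ℕ} (a : Fin n → A) : Condition n → Prop
  | .le φ r => φ.eval a ≤ r
  | .ge φ r => r ≤ φ.eval a

/-- The set `(A₁)ⁿ` of `n`-tuples of elements of the unit ball. -/
def unitBallTuples (A : Type u) [CStarAlgebra A] (n : ℕ) : Set (Fin n → A) :=
  {a | ∀ i, ‖a i‖ ≤ 1}

/-- The complete type (over the empty set) of a tuple. -/
def tp {A : Type u} [CStarAlgebra A] {n : ℕ} (a : Fin n → A) : Set (Condition n) :=
  {c | c.Sat a}

/-- The set of realizations of an `n`-type in `M`. -/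
def realizations {n : ℕ} (p : Set (Condition n)) (M : Type u) [CStarAlgebra M] :
    Set (Fin n → M) :=
  {b | b ∈ unitBallTuples M n ∧ ∀ c ∈ p, c.Sat b}

/-- `A` and `M` have the same theory. -/
def ElementarilyEquivalent (A M : Type u) [CStarAlgebra A] [CStarAlgebra M] : Prop :=
  ∀ φ : Formula 0, φ.eval (Fin.elim0 : Fin 0 → A) = φ.eval (Fin.elim0 : Fin 0 → M)

/-- A nonempty closed set `D ⊆ (M₁)ⁿ` is definable (over the empty set) in `M` if the distance to
`D`, in the max metric, is on `(M₁)ⁿ` a uniform limit of formulas. -/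
def IsDefinable {M : Type u} [CStarAlgebra M] {n : ℕ} (D : Set (Fin n → M)) : Prop :=
  D.Nonempty ∧ IsClosed D ∧ D ⊆ unitBallTuples M n ∧
    ∃ φ : ℕ → Formula n,
      TendstoUniformlyOn (fun k x => ((φ k).eval x : ℝ)) (fun x => Metric.infDist x D)
        Filter.atTop (unitBallTuples M n)

/-- The type `p` is principal over the complete theory of `A`: in every model of that theory the
set of realizations of `p` is a (nonempty) definable set. -/
def IsPrincipal (A : Type u) [CStarAlgebra A] {n : ℕ} (p : Set (Condition n)) : Prop :=
  ∀ (M : Type u) [CStarAlgebra M], ElementarilyEquivalent A M → IsDefinable (realizations p M)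

/-- `A` is an atomic model (of its theory): every complete type over the empty set realized in `A`
is principal. -/
def IsAtomic (A : Type u) [CStarAlgebra A] : Prop :=
  ∀ (n : ℕ) (a : Fin n → A), a ∈ unitBallTuples A n → IsPrincipal A (tp a)

end CStarLogic

/-! Let `e` be the image in `A` of the generators of one of the algebras in the sequence, and `ψ`
the stable formula defining them. A zero of `ψ` in `A` generates another copy of that algebra, so by
conjugacy an automorphism carries `e` to it; hence all zeros of `ψ` in `A` have the type of `e`
(`Formula.Defines.isolates`). Stability turns approximate zeros into zeros, so this passes to every
`M` elementarily equivalent to `A`.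

An arbitrary tuple `a` is a limit of tuples `t(e)`, with `t` *-polynomials and `e` varying. If `w`
in `M` has the type of some `v` near `a`, ever better approximations of `a` can be copied into `M`,
each close to the previous copy. The copies form a Cauchy sequence, whose limit realizes the type of
`a` near `w` (`ApproximatedByIsolated.exists_realization_near`). Only completeness of `M` is used,
not saturation.

So the realizations are, up to a small error, the values `t(z)` at zeros `z` of `ψ`. The distance to
them is approximated by minimizing `dist x t(y)` over `y`, with a penalty for `ψ(y)`
(`ApproximatedByIsolated.exists_formula_infDist`). -/

namespace CStarLogic

/-! ### *-polynomials: substitution, density of their values, Lipschitz bounds -/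

section Terms

variable {A B : Type u} [CStarAlgebra A] [CStarAlgebra B] {n k : ℕ}

/-- The `i`-th variable, as a term. -/
def Term.var (i : Fin n) : Term n := FreeAlgebra.ι ℂ (Sum.inl i)

@[simp] theorem Term.eval_var (i : Fin n) (a : Fin n → A) : (Term.var i).eval a = a i := by
  simp [Term.eval, Term.var]

@[simp] theorem Term.eval_ι_inl (i : Fin n) (a : Fin n → A) :
    Term.eval (FreeAlgebra.ι ℂ (Sum.inl i)) a = a i := by
  simp [Term.eval]

@[simp] theorem Term.eval_ι_inr (i : Fin n) (a : Fin n → A) :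
    Term.eval (FreeAlgebra.ι ℂ (Sum.inr i)) a = star (a i) := by
  simp [Term.eval]

@[simp] theorem Term.eval_algebraMap (r : ℂ) (a : Fin n → A) :
    Term.eval (algebraMap ℂ (Term n) r) a = algebraMap ℂ A r := by
  simp [Term.eval]

@[simp] theorem Term.eval_add (s t : Term n) (a : Fin n → A) :
    Term.eval (s + t) a = s.eval a + t.eval a := by
  simp [Term.eval]

@[simp] theorem Term.eval_sub (s t : Term n) (a : Fin n → A) :
    Term.eval (s - t) a = s.eval a - t.eval a := by
  simp [Term.eval]

@[simp] theorem Term.eval_mul (s t : Term n) (a : Fin n → A) :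
    Term.eval (s * t) a = s.eval a * t.eval a := by
  simp [Term.eval]

theorem Term.eval_map (Φ : A →⋆ₐ[ℂ] B) (t : Term n) (a : Fin n → A) :
    t.eval (fun i => Φ (a i)) = Φ (t.eval a) := by
  induction t using FreeAlgebra.induction with
  | grade0 r => simpa using (AlgHomClass.commutes Φ r).symm
  | grade1 x => rcases x with i | i <;> simp [map_star]
  | mul s t hs ht => simp [hs, ht]
  | add s t hs ht => simp [hs, ht]

/-- Conjugate scalars, swap the letters for `xᵢ` and `xᵢ*`, and reverse products. -/
theorem Term.exists_star (t : Term n) :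
    ∃ t' : Term n, ∀ (A : Type u) [CStarAlgebra A] (a : Fin n → A),
      t'.eval a = star (t.eval a) := by
  induction t using FreeAlgebra.induction with
  | grade0 r =>
    exact ⟨algebraMap ℂ _ (star r), fun A _ a => by
      simpa using algebraMap_star_comm (A := A) r⟩
  | grade1 x =>
    rcases x with i | i
    · exact ⟨FreeAlgebra.ι ℂ (Sum.inr i), fun A _ a => by simp⟩
    · exact ⟨FreeAlgebra.ι ℂ (Sum.inl i), fun A _ a => by simp⟩
  | mul s t hs ht =>
    obtain ⟨s', hs⟩ := hs
    obtain ⟨t', ht⟩ := ht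
    exact ⟨t' * s', fun A _ a => by simp [hs, ht]⟩
  | add s t hs ht =>
    obtain ⟨s', hs⟩ := hs
    obtain ⟨t', ht⟩ := ht
    exact ⟨s' + t', fun A _ a => by simp [hs, ht]⟩

theorem Term.exists_subst (t : Term n) (s : Fin n → Term k) :
    ∃ t' : Term k, ∀ (A : Type u) [CStarAlgebra A] (a : Fin k → A),
      t'.eval a = t.eval (fun i => (s i).eval a) := by
  induction t using FreeAlgebra.induction with
  | grade0 r => exact ⟨algebraMap ℂ _ r, fun A _ a => by simp⟩
  | grade1 x =>
    rcases x with i | i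
    · exact ⟨s i, fun A _ a => by simp⟩
    · obtain ⟨t', ht⟩ := Term.exists_star.{u} (s i)
      exact ⟨t', fun A _ a => by simp [ht]⟩
  | mul s t hs ht =>
    obtain ⟨s', hs⟩ := hs
    obtain ⟨t', ht⟩ := ht
    exact ⟨s' * t', fun A _ a => by simp [hs, ht]⟩
  | add s t hs ht =>
    obtain ⟨s', hs⟩ := hs
    obtain ⟨t', ht⟩ := ht
    exact ⟨s' + t', fun A _ a => by simp [hs, ht]⟩

theorem Term.exists_eval_eq_of_mem_adjoin (g : Fin k → A) {x : A}
    (hx : x ∈ StarAlgebra.adjoin ℂ (Set.range g)) : ∃ t : Term k, t.eval g = x := by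
  induction hx using StarAlgebra.adjoin_induction with
  | mem x hx =>
    obtain ⟨i, rfl⟩ := hx
    exact ⟨Term.var i, by simp⟩
  | algebraMap r => exact ⟨algebraMap ℂ _ r, by simp⟩
  | add x y _ _ hx hy =>
    obtain ⟨s, rfl⟩ := hx
    obtain ⟨t, rfl⟩ := hy
    exact ⟨s + t, by simp⟩
  | mul x y _ _ hx hy =>
    obtain ⟨s, rfl⟩ := hx
    obtain ⟨t, rfl⟩ := hy
    exact ⟨s * t, by simp⟩
  | star x _ hx =>
    obtain ⟨s, rfl⟩ := hx
    obtain ⟨t, ht⟩ := Term.exists_star.{u} s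
    exact ⟨t, ht _ _⟩

/-- Terms are Lipschitz on bounded sets. -/
theorem Term.exists_lipschitz (t : Term n) (R : ℝ) :
    ∃ L : ℝ, 0 ≤ L ∧ ∀ a b : Fin n → A, ‖a‖ ≤ R → ‖b‖ ≤ R →
      ‖t.eval a - t.eval b‖ ≤ L * ‖a - b‖ := by
  induction t using FreeAlgebra.induction with
  | grade0 r => exact ⟨0, le_rfl, fun a b _ _ => by simp⟩
  | grade1 x =>
    refine ⟨1, zero_le_one, fun a b _ _ => ?_⟩
    rcases x with i | i
    · simpa using norm_le_pi_norm (a - b) i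
    · simpa [← star_sub] using norm_le_pi_norm (a - b) i
  | add s t hs ht =>
    obtain ⟨L, hL0, hL⟩ := hs
    obtain ⟨L', hL0', hL'⟩ := ht
    refine ⟨L + L', add_nonneg hL0 hL0', fun a b ha hb => ?_⟩
    rw [Term.eval_add, Term.eval_add, add_sub_add_comm, add_mul]
    exact (norm_add_le _ _).trans (add_le_add (hL a b ha hb) (hL' a b ha hb))
  | mul s t hs ht =>
    obtain ⟨L, hL0, hL⟩ := hs
    obtain ⟨L', hL0', hL'⟩ := ht
    obtain ⟨P, hP⟩ := Term.eval_bounded (A := A) s R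
    obtain ⟨Q, hQ⟩ := Term.eval_bounded (A := A) t R
    refine ⟨|P| * L' + L * |Q|, by positivity, fun a b ha hb => ?_⟩
    have h1 : ‖Term.eval s a‖ ≤ |P| :=
      (hP a fun i => (norm_le_pi_norm a i).trans ha).trans (le_abs_self P)
    have h2 : ‖Term.eval t b‖ ≤ |Q| :=
      (hQ b fun i => (norm_le_pi_norm b i).trans hb).trans (le_abs_self Q)
    have key : Term.eval s a * Term.eval t a - Term.eval s b * Term.eval t b =
        Term.eval s a * (Term.eval t a - Term.eval t b) +
          (Term.eval s a - Term.eval s b) * Term.eval t b := by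
      rw [mul_sub, sub_mul]; abel
    rw [Term.eval_mul, Term.eval_mul, key]
    calc _ ≤ ‖Term.eval s a‖ * ‖Term.eval t a - Term.eval t b‖ +
            ‖Term.eval s a - Term.eval s b‖ * ‖Term.eval t b‖ :=
          (norm_add_le _ _).trans (add_le_add (norm_mul_le _ _) (norm_mul_le _ _))
      _ ≤ |P| * (L' * ‖a - b‖) + (L * ‖a - b‖) * |Q| := by
          gcongr
          · exact hL' a b ha hb
          · exact hL a b ha hb
      _ = _ := by ring

end Terms

/-! ### Formulas: continuity, invariance under isomorphism, substitution, iterated infima -/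

section Formulas

variable {A B : Type u} [CStarAlgebra A] [CStarAlgebra B] {n m k : ℕ}

theorem norm_snoc_le {K : ℕ} {R : ℝ} {a : Fin n → A} (ha : ‖a‖ ≤ R) {x : A} (hx : ‖x‖ ≤ K) :
    ‖(Fin.snoc a x : Fin (n + 1) → A)‖ ≤ max R K := by
  rw [pi_norm_le_iff_of_nonneg (le_max_of_le_right (Nat.cast_nonneg K))]
  intro i
  refine Fin.lastCases ?_ (fun j => ?_) i
  · simpa using Or.inr hx
  · simpa using Or.inl ((norm_le_pi_norm a j).trans ha)

theorem snoc_sub_snoc_same (a b : Fin n → A) (x : A) :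
    ‖(Fin.snoc a x - Fin.snoc b x : Fin (n + 1) → A)‖ = ‖a - b‖ := by
  refine le_antisymm ?_ ?_
  · rw [pi_norm_le_iff_of_nonneg (norm_nonneg _)]
    intro i
    refine Fin.lastCases ?_ (fun j => ?_) i
    · simp
    · simpa using norm_le_pi_norm (a - b) j
  · rw [pi_norm_le_iff_of_nonneg (norm_nonneg _)]
    intro j
    have := norm_le_pi_norm (Fin.snoc a x - Fin.snoc b x : Fin (n + 1) → A) j.castSucc
    rwa [Pi.sub_apply, Fin.snoc_castSucc, Fin.snoc_castSucc] at this

instance (A : Type u) [CStarAlgebra A] (K : ℕ) : Nonempty {x : A // ‖x‖ ≤ K} :=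
  ⟨⟨0, by simp⟩⟩

theorem Formula.bddAbove_eval_snoc (φ : Formula (n + 1)) (K : ℕ) (a : Fin n → A) :
    BddAbove (Set.range fun x : {x : A // ‖x‖ ≤ K} =>
      φ.eval (Fin.snoc a x.1 : Fin (n + 1) → A)) := by
  obtain ⟨c, hc⟩ := φ.eval_bounded (A := A) (max ‖a‖ K)
  refine ⟨c, ?_⟩
  rintro _ ⟨x, rfl⟩
  exact hc _ fun i => (norm_le_pi_norm _ i).trans (norm_snoc_le le_rfl x.2)

/-- Formulas are uniformly continuous on bounded sets. -/
theorem Formula.uniformContinuousOn (φ : Formula n) (R : ℝ) {ε : ℝ} (hε : 0 < ε) :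
    ∃ δ : ℝ, 0 < δ ∧ ∀ a b : Fin n → A, ‖a‖ ≤ R → ‖b‖ ≤ R → ‖a - b‖ < δ →
      dist (φ.eval a) (φ.eval b) < ε := by
  have le_add : ∀ {x y : ℝ≥0} {e : ℝ} (he : 0 < e), dist x y < e → x ≤ y + e.toNNReal := by
    intro x y e he h
    rw [NNReal.dist_eq, abs_sub_lt_iff] at h
    rw [← NNReal.coe_le_coe, NNReal.coe_add, Real.coe_toNNReal _ he.le]
    linarith [h.1]
  have dist_lt : ∀ {x y : ℝ≥0} {e : ℝ} (he : 0 < e / 2), x ≤ y + (e / 2).toNNReal →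
      y ≤ x + (e / 2).toNNReal → dist x y < e := by
    intro x y e he h1 h2
    rw [← NNReal.coe_le_coe, NNReal.coe_add, Real.coe_toNNReal _ he.le] at h1 h2
    rw [NNReal.dist_eq, abs_sub_lt_iff]
    constructor <;> linarith
  induction φ generalizing R ε with
  | norm t =>
    obtain ⟨L, hL0, hL⟩ := t.exists_lipschitz (A := A) R
    refine ⟨ε / (L + 1), by positivity, fun a b ha hb hab => ?_⟩
    rw [NNReal.dist_eq]
    calc |‖t.eval a‖ - ‖t.eval b‖| ≤ ‖t.eval a - t.eval b‖ := abs_norm_sub_norm_le _ _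
      _ ≤ L * ‖a - b‖ := hL a b ha hb
      _ ≤ (L + 1) * ‖a - b‖ := by gcongr; linarith
      _ < ε := by rwa [lt_div_iff₀' (by positivity)] at hab
  | conn f φ ψ hφ hψ =>
    obtain ⟨P, hP⟩ := φ.eval_bounded (A := A) R
    obtain ⟨Q, hQ⟩ := ψ.eval_bounded (A := A) R
    -- A connective is merely continuous, so its modulus is taken on the compact rectangle
    -- containing the values.
    have hf := (isCompact_Icc (a := ((0, 0) : ℝ≥0 × ℝ≥0)) (b := (P, Q))).uniformContinuousOn_of_continuous
      f.continuous.continuousOn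
    obtain ⟨η, hη, h⟩ := Metric.uniformContinuousOn_iff.1 hf ε hε
    obtain ⟨δ₁, hδ₁, h₁⟩ := hφ R hη
    obtain ⟨δ₂, hδ₂, h₂⟩ := hψ R hη
    refine ⟨min δ₁ δ₂, lt_min hδ₁ hδ₂, fun a b ha hb hab => ?_⟩
    refine h _ ?_ _ ?_ ?_
    · exact ⟨⟨zero_le, zero_le⟩, hP _ fun i => (norm_le_pi_norm a i).trans ha,
        hQ _ fun i => (norm_le_pi_norm a i).trans ha⟩
    · exact ⟨⟨zero_le, zero_le⟩, hP _ fun i => (norm_le_pi_norm b i).trans hb,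
        hQ _ fun i => (norm_le_pi_norm b i).trans hb⟩
    · exact max_lt (h₁ a b ha hb (hab.trans_le (min_le_left _ _)))
        (h₂ a b ha hb (hab.trans_le (min_le_right _ _)))
  | inf K φ h =>
    obtain ⟨δ, hδ, h⟩ := h (max R K) (half_pos hε)
    have key : ∀ a b : Fin _ → A, ‖a‖ ≤ R → ‖b‖ ≤ R → ‖a - b‖ < δ → (Formula.inf K φ).eval a ≤
        (Formula.inf K φ).eval b + (ε / 2).toNNReal := by
      intro a b ha hb hab
      rw [← tsub_le_iff_right]
      refine le_ciInf fun x => ?_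
      rw [tsub_le_iff_right]
      refine (ciInf_le (OrderBot.bddBelow _) x).trans (le_add (half_pos hε) (h _ _ ?_ ?_ ?_))
      · exact norm_snoc_le ha x.2
      · exact norm_snoc_le hb x.2
      · rwa [snoc_sub_snoc_same]
    exact ⟨δ, hδ, fun a b ha hb hab => dist_lt (half_pos hε) (key a b ha hb hab)
      (key b a hb ha (by rwa [norm_sub_rev]))⟩
  | sup K φ h =>
    obtain ⟨δ, hδ, h⟩ := h (max R K) (half_pos hε)
    have key : ∀ a b : Fin _ → A, ‖a‖ ≤ R → ‖b‖ ≤ R → ‖a - b‖ < δ → (Formula.sup K φ).eval a ≤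
        (Formula.sup K φ).eval b + (ε / 2).toNNReal := by
      intro a b ha hb hab
      refine ciSup_le fun x => ?_
      refine (le_add (half_pos hε) (h _ _ ?_ ?_ ?_)).trans
        (add_le_add_left (le_ciSup (φ.bddAbove_eval_snoc K b) x) _)
      · exact norm_snoc_le ha x.2
      · exact norm_snoc_le hb x.2
      · rwa [snoc_sub_snoc_same]
    exact ⟨δ, hδ, fun a b ha hb hab => dist_lt (half_pos hε) (key a b ha hb hab)
      (key b a hb ha (by rwa [norm_sub_rev]))⟩

theorem Formula.continuous (φ : Formula n) : Continuous (φ.eval : (Fin n → A) → ℝ≥0) := by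
  rw [Metric.continuous_iff]
  intro b ε hε
  obtain ⟨δ, hδ, h⟩ := φ.uniformContinuousOn (A := A) (‖b‖ + 1) hε
  refine ⟨min δ 1, lt_min hδ one_pos, fun a hab => ?_⟩
  rw [dist_eq_norm] at hab
  refine h a b ?_ (by linarith) (hab.trans_le (min_le_left _ _))
  have := hab.trans_le (min_le_right _ _)
  linarith [norm_le_norm_add_norm_sub' a b]

/-- An isomorphism is isometric and maps balls bijectively onto balls; surjectivity is what handles
the quantifiers. -/
theorem Formula.eval_equiv (σ : A ≃⋆ₐ[ℂ] B) (φ : Formula n) (a : Fin n → A) :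
    φ.eval (fun i => σ (a i)) = φ.eval a := by
  have hnorm : ∀ x : A, ‖σ x‖ = ‖x‖ := fun x => by
    simpa using NonUnitalStarAlgHom.norm_map (σ : A →⋆ₐ[ℂ] B) σ.injective x
  have hsnoc : ∀ {n : ℕ} (a : Fin n → A) (x : A), (Fin.snoc (fun i => σ (a i)) (σ x) :
      Fin (n + 1) → B) = fun i => σ ((Fin.snoc a x : Fin (n + 1) → A) i) := by
    intro n a x
    ext i
    refine Fin.lastCases ?_ (fun j => ?_) i <;> simp
  let e : ∀ K : ℕ, {x : A // ‖x‖ ≤ K} ≃ {x : B // ‖x‖ ≤ K} := fun K =>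
    σ.toEquiv.subtypeEquiv fun x => by
      change _ ↔ ‖σ x‖ ≤ K
      rw [hnorm]
  induction φ with
  | norm t =>
    have := t.eval_map (σ : A →⋆ₐ[ℂ] B) a
    simp only [StarAlgHom.coe_coe, StarAlgHom.coe_coe] at this
    ext
    simp [Formula.eval, this, hnorm]
  | conn f φ ψ hφ hψ => simp only [Formula.eval, hφ, hψ]
  | inf K φ h =>
    refine ((e K).iInf_congr fun x => ?_).symm
    rw [← h]
    exact congrArg _ (hsnoc a x.1)
  | sup K φ h =>
    refine ((e K).iSup_congr fun x => ?_).symm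
    rw [← h]
    exact congrArg _ (hsnoc a x.1)

theorem Formula.exists_subst (φ : Formula n) (s : Fin n → Term k) :
    ∃ φ' : Formula k, ∀ (A : Type u) [CStarAlgebra A] (a : Fin k → A),
      φ'.eval a = φ.eval (fun i => (s i).eval a) := by
  -- Under a quantifier the substitution is extended so as to fix the bound last variable.
  have lift : ∀ {n k : ℕ} (s : Fin n → Term k), ∃ s' : Fin (n + 1) → Term (k + 1),
      ∀ (A : Type u) [CStarAlgebra A] (a : Fin k → A) (x : A),
        (fun i => (s' i).eval (Fin.snoc a x : Fin (k + 1) → A)) =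
          (Fin.snoc (fun i => (s i).eval a) x : Fin (n + 1) → A) := by
    intro n k s
    choose s' hs' using fun i => Term.exists_subst.{u} (s i) fun j => Term.var j.castSucc
    refine ⟨Fin.snoc s' (Term.var (Fin.last k)), fun A _ a x => ?_⟩
    ext i
    refine Fin.lastCases ?_ (fun j => ?_) i
    · simp
    · simp [hs']
  induction φ generalizing k with
  | norm t =>
    obtain ⟨t', ht⟩ := Term.exists_subst.{u} t s
    exact ⟨.norm t', fun A _ a => by simp [Formula.eval, ht]⟩
  | conn f φ ψ hφ hψ =>
    obtain ⟨φ', hφ⟩ := hφ s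
    obtain ⟨ψ', hψ⟩ := hψ s
    exact ⟨.conn f φ' ψ', fun A _ a => by simp [Formula.eval, hφ, hψ]⟩
  | inf K φ h =>
    obtain ⟨s', hs⟩ := lift s
    obtain ⟨φ', hφ⟩ := h s'
    exact ⟨.inf K φ', fun A _ a => by simp only [Formula.eval, hφ, hs]⟩
  | sup K φ h =>
    obtain ⟨s', hs⟩ := lift s
    obtain ⟨φ', hφ⟩ := h s'
    exact ⟨.sup K φ', fun A _ a => by simp only [Formula.eval, hφ, hs]⟩

/-- The maximum of the norms of finitely many terms is a formula. -/
theorem Formula.exists_piNorm (t : Fin m → Term n) :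
    ∃ φ : Formula n, ∀ (A : Type u) [CStarAlgebra A] (a : Fin n → A),
      (φ.eval a : ℝ) = ‖fun i => (t i).eval a‖ := by
  suffices h : ∀ s : Finset (Fin m), ∃ φ : Formula n, ∀ (A : Type u) [CStarAlgebra A]
      (a : Fin n → A), φ.eval a = s.sup fun i => ‖(t i).eval a‖₊ by
    obtain ⟨φ, hφ⟩ := h Finset.univ
    exact ⟨φ, fun A _ a => by rw [hφ, Pi.norm_def]⟩
  intro s
  induction s using Finset.induction_on with
  | empty => exact ⟨.norm 0, fun A _ a => by simp [Formula.eval, Term.eval]⟩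
  | insert i s _ h =>
    obtain ⟨φ, hφ⟩ := h
    refine ⟨.conn ⟨fun p => max p.1 p.2, by fun_prop⟩ (.norm (t i)) φ, fun A _ a => ?_⟩
    simp [Formula.eval, hφ, Finset.sup_insert]

/-- The infimum over a tuple of variables ranging over the ball of radius `K`. -/
def Formula.infs (K : ℕ) : (k : ℕ) → Formula (m + k) → Formula m
  | 0, φ => φ
  | k + 1, φ => Formula.infs K k (.inf K φ)

/-- The infimum need not be attained, so strict inequalities are the ones equivalent to having a
witness. -/
theorem Formula.infs_lt_iff (K : ℕ) (φ : Formula (m + k)) (a : Fin m → A) (r : ℝ≥0) :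
    (Formula.infs K k φ).eval a < r ↔
      ∃ y : Fin k → A, (∀ i, ‖y i‖ ≤ K) ∧ φ.eval (Fin.append a y) < r := by
  induction k with
  | zero =>
    have : ∀ y : Fin 0 → A, Fin.append a y = a := fun y => by
      rw [Subsingleton.elim y Fin.elim0, Fin.append_elim0]; rfl
    simp [Formula.infs, this]
  | succ k ih =>
    rw [Formula.infs, ih]
    constructor
    · rintro ⟨y, hy, h⟩
      obtain ⟨x, hx⟩ := exists_lt_of_ciInf_lt h
      refine ⟨Fin.snoc y x.1, fun i => ?_, ?_⟩
      · refine Fin.lastCases ?_ (fun j => ?_) i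
        · simpa using x.2
        · simpa using hy j
      · rwa [Fin.append_snoc]
    · rintro ⟨y, hy, h⟩
      refine ⟨Fin.init y, fun i => hy _, ?_⟩
      refine (ciInf_le (OrderBot.bddBelow _) ⟨y (Fin.last k), hy _⟩).trans_lt ?_
      rwa [← Fin.append_snoc, Fin.snoc_init_self]

end Formulas

/-! ### Types, isolation by stable formulas, and definability of the realizations -/

section Types

variable {A B M : Type u} [CStarAlgebra A] [CStarAlgebra B] [CStarAlgebra M] {n m k : ℕ}

/-- Two tuples, in possibly different algebras, satisfy the same conditions. -/
def SameType (v : Fin m → A) (w : Fin m → B) : Prop :=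
  ∀ φ : Formula m, φ.eval v = φ.eval w

theorem SameType.symm {v : Fin m → A} {w : Fin m → B} (h : SameType v w) : SameType w v :=
  fun φ => (h φ).symm

theorem SameType.eval_terms {v : Fin m → A} {w : Fin m → B} (h : SameType v w)
    (t : Fin k → Term m) : SameType (fun i => (t i).eval v) (fun i => (t i).eval w) := by
  intro φ
  obtain ⟨φ', hφ⟩ := Formula.exists_subst.{u} φ t
  rw [← hφ, ← hφ, h]

theorem mem_realizations_tp_iff {a : Fin m → A} (ha : a ∈ unitBallTuples A m) {w : Fin m → M} :
    w ∈ realizations (tp a) M ↔ SameType a w := by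
  constructor
  · rintro ⟨-, h⟩ φ
    exact le_antisymm (h (.ge φ (φ.eval a)) (le_refl (φ.eval a)))
      (h (.le φ (φ.eval a)) (le_refl (φ.eval a)))
  · refine fun h => ⟨fun i => ?_, fun c hc => ?_⟩
    · have := congrArg NNReal.toReal (h (.norm (Term.var i)))
      simp only [Formula.eval, Term.eval_var, coe_nnnorm] at this
      exact this ▸ ha i
    · cases c with
      | le φ r => exact (h φ).symm.trans_le hc
      | ge φ r => exact (show r ≤ φ.eval a from hc).trans_eq (h φ)

/-- In every algebra the zeros of `ψ` lie in the ball of radius `K`. -/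
def Formula.ZerosBoundedBy (ψ : Formula k) (K : ℕ) : Prop :=
  ∀ (B : Type u) [CStarAlgebra B] (b : Fin k → B), ψ.eval b = 0 → ‖b‖ ≤ K

theorem norm_append_le {x : Fin m → A} {y : Fin k → A} {R S : ℝ} (hx : ‖x‖ ≤ R) (hy : ‖y‖ ≤ S) :
    ‖Fin.append x y‖ ≤ max R S := by
  rw [pi_norm_le_iff_of_nonneg (le_max_of_le_left ((norm_nonneg _).trans hx))]
  refine fun i => Fin.addCases (fun i => ?_) (fun i => ?_) i
  · simpa using Or.inl ((norm_le_pi_norm x i).trans hx)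
  · simpa using Or.inr ((norm_le_pi_norm y i).trans hy)

/-- Stability moves `y` to a true zero `z`, and uniform continuity controls the change of `χ`. The
latter holds only on bounded sets, hence the bound `K` on zeros. -/
theorem Formula.IsStable.exists_zero_near {ψ : Formula k} (hψ : Formula.IsStable.{u} ψ) {K : ℕ}
    (hK : Formula.ZerosBoundedBy.{u} ψ K) (χ : Formula (m + k)) (R : ℝ) {ε : ℝ} (hε : 0 < ε) :
    ∃ δ : ℝ, 0 < δ ∧ ∀ (x : Fin m → B) (y : Fin k → B), ‖x‖ ≤ R → ‖y‖ ≤ K → (ψ.eval y : ℝ) < δ →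
      ∃ z : Fin k → B, ψ.eval z = 0 ∧
        dist (χ.eval (Fin.append x y)) (χ.eval (Fin.append x z)) < ε := by
  obtain ⟨η, hη, h⟩ := χ.uniformContinuousOn (A := B) (max R K) hε
  obtain ⟨δ, hδ, hs⟩ := hψ η hη
  refine ⟨δ, hδ, fun x y hx hy hyδ => ?_⟩
  obtain ⟨z, hz, hz0⟩ := hs B y hyδ
  refine ⟨z, hz0, h _ _ (norm_append_le hx hy) (norm_append_le hx (hK B z hz0)) ?_⟩
  rw [pi_norm_lt_iff hη]
  refine fun i => Fin.addCases (fun i => ?_) (fun i => ?_) i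
  · simpa using hη
  · simpa using hz i

/-- Zeros of a stable formula can be transferred along an equality of types, with approximate
control of one further formula. -/
theorem SameType.exists_zero {ψ : Formula k} (hψ : Formula.IsStable.{u} ψ) {K : ℕ}
    (hK : Formula.ZerosBoundedBy.{u} ψ K) {x : Fin m → A} {x' : Fin m → B} (h : SameType x x')
    (χ : Formula (m + k)) {z : Fin k → A} (hz : ψ.eval z = 0) {ε : ℝ} (hε : 0 < ε) :
    ∃ z' : Fin k → B, ψ.eval z' = 0 ∧
      dist (χ.eval (Fin.append x' z')) (χ.eval (Fin.append x z)) < ε := by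
  obtain ⟨ψ', hψ'⟩ := Formula.exists_subst.{u} ψ fun i => Term.var (Fin.natAdd m i)
  obtain ⟨δ, hδ, hnear⟩ := hψ.exists_zero_near (B := B) hK χ ‖x'‖ (half_pos hε)
  -- The value `s` enters `θ` as a constant of the connective. Since `θ` vanishes at `x`, it is
  -- small at `x'`, which yields an approximate zero `y` with `χ` near `s`; stability then corrects
  -- `y`.
  let s := χ.eval (Fin.append x z)
  let θ : Formula m := .infs K k
    (.conn ⟨fun p => max p.1 (nndist p.2 s), by fun_prop⟩ ψ' χ)
  have hr : 0 < min δ (ε / 2) := lt_min hδ (half_pos hε)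
  have hx : θ.eval x < (min δ (ε / 2)).toNNReal := by
    refine (Formula.infs_lt_iff K _ x _).2
      ⟨z, fun i => (norm_le_pi_norm z i).trans (hK A z hz), ?_⟩
    simpa [Formula.eval, hψ', hz, s] using hr
  rw [h θ] at hx
  obtain ⟨y, hy, hyr⟩ := (Formula.infs_lt_iff K _ x' _).1 hx
  simp only [Formula.eval, ContinuousMap.coe_mk, hψ', Term.eval_var, Fin.append_right, max_lt_iff,
    Real.lt_toNNReal_iff_coe_lt, lt_min_iff, coe_nndist] at hyr
  obtain ⟨z', hz', hd⟩ := hnear x' y le_rfl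
    ((pi_norm_le_iff_of_nonneg (Nat.cast_nonneg K)).2 hy) hyr.1.1
  refine ⟨z', hz', ?_⟩
  rw [dist_comm] at hd
  exact (dist_triangle _ (χ.eval (Fin.append x' y)) _).trans_lt (by linarith [hyr.2.2])

theorem Formula.exists_dist (t : Fin m → Term k) :
    ∃ χ : Formula (m + k), ∀ (B : Type u) [CStarAlgebra B] (x : Fin m → B) (y : Fin k → B),
      (χ.eval (Fin.append x y) : ℝ) = dist x (fun i => (t i).eval y) := by
  choose t' ht' using fun i => Term.exists_subst.{u} (t i) fun j => Term.var (Fin.natAdd m j)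
  obtain ⟨χ, hχ⟩ := Formula.exists_piNorm.{u} fun i => Term.var (Fin.castAdd k i) - t' i
  refine ⟨χ, fun B _ x y => ?_⟩
  rw [hχ, dist_eq_norm]
  congr 1
  ext i
  simp [ht']

/-- `ψ` is a stable formula with bounded zero-sets, whose zeros in `A` all have the type of
`e`. -/
structure Formula.Isolates (ψ : Formula k) (e : Fin k → A) : Prop where
  stable : Formula.IsStable.{u} ψ
  bounded : ∃ K, Formula.ZerosBoundedBy.{u} ψ K
  zero : ψ.eval e = 0
  sameType : ∀ z : Fin k → A, ψ.eval z = 0 → SameType e z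

/-- The empty tuples have the same type, so zeros transfer between `A` and `M` by the case `m = 0`
of `SameType.exists_zero`. -/
theorem ElementarilyEquivalent.sameType (hM : ElementarilyEquivalent A M) (v : Fin 0 → A)
    (w : Fin 0 → M) : SameType v w := by
  intro φ
  rw [Subsingleton.elim v Fin.elim0, Subsingleton.elim w Fin.elim0, hM]

theorem Formula.Isolates.exists_zero {ψ : Formula k} {e : Fin k → A} (h : ψ.Isolates e)
    (hM : ElementarilyEquivalent A M) : ∃ z : Fin k → M, ψ.eval z = 0 := by
  obtain ⟨K, hK⟩ := h.bounded
  obtain ⟨z, hz, -⟩ := (hM.sameType Fin.elim0 Fin.elim0).exists_zero h.stable hK (.norm 0) h.zero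
    one_pos
  exact ⟨z, hz⟩

/-- For each `φ`, transfer `z` back to a zero in `A` with nearly the same value of `φ`; there that
value is `φ(e)`. -/
theorem Formula.Isolates.sameType_of_elementarilyEquivalent {ψ : Formula k} {e : Fin k → A}
    (h : ψ.Isolates e) (hM : ElementarilyEquivalent A M) {z : Fin k → M} (hz : ψ.eval z = 0) :
    SameType e z := by
  intro φ
  obtain ⟨K, hK⟩ := h.bounded
  obtain ⟨φ', hφ⟩ := Formula.exists_subst.{u} φ fun i => Term.var (Fin.natAdd 0 i)
  refine eq_of_forall_dist_le fun ε hε => ?_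
  obtain ⟨z', hz', hd⟩ := (hM.sameType Fin.elim0 Fin.elim0).symm.exists_zero h.stable hK φ' hz hε
  simp only [hφ, Term.eval_var, Fin.append_right] at hd
  rw [h.sameType z' hz' φ]
  exact hd.le

/-- `a` is a limit of tuples of terms evaluated at isolated tuples. -/
def ApproximatedByIsolated (a : Fin m → A) : Prop :=
  ∀ ε : ℝ, 0 < ε → ∃ (k : ℕ) (ψ : Formula k) (e : Fin k → A) (t : Fin m → Term k),
    ψ.Isolates e ∧ dist (fun i => (t i).eval e) a < ε

/-- Take `v' = t(e)` within `δ'` of `a`, so `dist v v' < δ + δ'`. Transferring `e` to a zero `z` in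
`M` gives `w' = t(z)`, at the cost of another `δ'`. -/
theorem ApproximatedByIsolated.exists_sameType_near {a : Fin m → A}
    (H : ApproximatedByIsolated a) (hM : ElementarilyEquivalent A M) {v : Fin m → A}
    {w : Fin m → M} (h : SameType v w) {δ δ' : ℝ} (hv : dist v a < δ) (hδ' : 0 < δ') :
    ∃ (v' : Fin m → A) (w' : Fin m → M),
      SameType v' w' ∧ dist v' a < δ' ∧ dist w w' < δ + 2 * δ' := by
  obtain ⟨k, ψ, e, t, hψ, hte⟩ := H δ' hδ'
  obtain ⟨K, hK⟩ := hψ.bounded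
  obtain ⟨χ, hχ⟩ := Formula.exists_dist.{u} t
  obtain ⟨z, hz, hd⟩ := h.exists_zero hψ.stable hK χ hψ.zero hδ'
  refine ⟨_, fun i => (t i).eval z,
    (hψ.sameType_of_elementarilyEquivalent hM hz).eval_terms t, hte, ?_⟩
  rw [NNReal.dist_eq, hχ, hχ, abs_sub_lt_iff] at hd
  linarith [hd.1, dist_triangle_right v (fun i => (t i).eval e) a]

theorem ApproximatedByIsolated.exists_realization_near {a : Fin m → A}
    (H : ApproximatedByIsolated a) (hM : ElementarilyEquivalent A M) {v : Fin m → A}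
    {w : Fin m → M} (h : SameType v w) {δ : ℝ} (hv : dist v a < δ) :
    ∃ d : Fin m → M, SameType a d ∧ dist w d ≤ 4 * δ := by
  have hδ : 0 < δ := dist_nonneg.trans_lt hv
  let P : ℕ → (Fin m → A) × (Fin m → M) → Prop := fun n p =>
    SameType p.1 p.2 ∧ dist p.1 a < δ / 2 ^ n
  -- With `δ' = δ / 2 ^ (n + 1)` a step has length below `2 * δ / 2 ^ n`, written in the form whose
  -- geometric sum is `4 * δ`.
  have step : ∀ n (p : {p // P n p}), ∃ p' : {p // P (n + 1) p},
      dist p.1.2 p'.1.2 < 4 * δ / 2 / 2 ^ n := by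
    rintro n ⟨p, hp, hpa⟩
    obtain ⟨v', w', h1, h2, h3⟩ :=
      H.exists_sameType_near hM hp hpa (δ' := δ / 2 ^ (n + 1)) (by positivity)
    refine ⟨⟨(v', w'), h1, h2⟩, h3.trans_eq ?_⟩
    field_simp
    ring
  choose f hf using step
  let s : ∀ n, {p // P n p} := fun n =>
    Nat.rec ⟨(v, w), h, by simpa using hv⟩ (fun n p => f n p) n
  have hs : ∀ n, dist (s n).1.2 (s (n + 1)).1.2 ≤ 4 * δ / 2 / 2 ^ n := fun n => (hf n (s n)).le
  obtain ⟨d, hd⟩ := cauchySeq_tendsto_of_complete (cauchySeq_of_le_geometric_two hs)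
  have hva : Filter.Tendsto (fun n => (s n).1.1) Filter.atTop (nhds a) := by
    rw [tendsto_iff_dist_tendsto_zero]
    refine squeeze_zero (fun _ => dist_nonneg) (fun n => (s n).2.2.le) ?_
    simpa [div_eq_mul_inv] using
      (tendsto_pow_atTop_nhds_zero_of_lt_one (r := (2 : ℝ)⁻¹) (by norm_num)
        (by norm_num)).const_mul δ
  refine ⟨d, fun φ => ?_, dist_le_of_le_geometric_two_of_tendsto₀ hs hd⟩
  -- Both sides are limits of the common value of `φ` at the `n`-th pair.
  refine tendsto_nhds_unique ((φ.continuous.tendsto a).comp hva) ?_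
  refine ((φ.continuous.tendsto d).comp hd).congr fun n => ?_
  exact ((s n).2.1 φ).symm

/-- The distance to the set of realizations is, up to an arbitrarily small error, a formula. -/
theorem ApproximatedByIsolated.exists_formula_infDist {a : Fin m → A}
    (H : ApproximatedByIsolated a) (ha : a ∈ unitBallTuples A m)
    (hM : ElementarilyEquivalent A M) (hD : (realizations (tp a) M).Nonempty) {ε : ℝ}
    (hε : 0 < ε) :
    ∃ φ : Formula m, ∀ x ∈ unitBallTuples M m,
      |(φ.eval x : ℝ) - Metric.infDist x (realizations (tp a) M)| ≤ 6 * ε := by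
  obtain ⟨k, ψ, e, t, hψ, hte⟩ := H ε hε
  obtain ⟨K, hK⟩ := hψ.bounded
  obtain ⟨χ, hχ⟩ := Formula.exists_dist.{u} t
  obtain ⟨ψ', hψ'⟩ := Formula.exists_subst.{u} ψ fun i => Term.var (Fin.natAdd m i)
  obtain ⟨δ, hδ, hnear⟩ := hψ.stable.exists_zero_near (B := M) hK χ 1 hε
  -- Distances from the unit ball to the realizations are at most 2, so a penalty `c * ψ(y)` below 2
  -- must force `ψ(y) < δ`; any constant at least `2 / δ` would do.
  let c : ℝ≥0 := (3 / δ).toNNReal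
  have hc : (c : ℝ) = 3 / δ := Real.coe_toNNReal _ (by positivity)
  refine ⟨.infs K k (.conn ⟨fun p => max (c * p.1) p.2, by fun_prop⟩ ψ' χ), fun x hx => ?_⟩
  have hx1 : ‖x‖ ≤ 1 := (pi_norm_le_iff_of_nonneg zero_le_one).2 hx
  set D := realizations (tp a) M with hDdef
  rw [abs_sub_le_iff, sub_le_iff_le_add, sub_le_iff_le_add]
  constructor
  -- A realization `d` near `x` has a zero `z` with `dist d t(z) < 2 * ε`, and at `z` the penalty
  -- vanishes.
  · refine le_of_forall_gt fun r hr => ?_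
    have hr0 : 0 < r := lt_of_le_of_lt (by positivity [Metric.infDist_nonneg (x := x) (s := D)]) hr
    obtain ⟨d, hd, hxd⟩ := (Metric.infDist_lt_iff hD).1
      (show Metric.infDist x D < r - 2 * ε by linarith)
    obtain ⟨z, hz, hdz⟩ := ((mem_realizations_tp_iff ha).1 hd).exists_zero hψ.stable hK χ
      hψ.zero hε
    rw [NNReal.dist_eq, hχ, hχ, abs_sub_lt_iff, dist_comm a] at hdz
    rw [← Real.lt_toNNReal_iff_coe_lt, Formula.infs_lt_iff]
    refine ⟨z, fun i => (norm_le_pi_norm z i).trans (hK M z hz), ?_⟩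
    simp only [Formula.eval, ContinuousMap.coe_mk, hψ', Term.eval_var, Fin.append_right, hz,
      mul_zero, Real.lt_toNNReal_iff_coe_lt, hχ, zero_le, sup_of_le_right]
    linarith [dist_triangle x d fun i => (t i).eval z, hdz.1]
  -- A witness `y` is corrected to a zero `z` at cost `ε`, and `t(z)` lies within `4 * ε` of a
  -- realization: `5 * ε` in total.
  · by_contra! hlt
    obtain ⟨d₀, hd₀⟩ := hD
    have h2 : Metric.infDist x D ≤ 2 := by
      refine (Metric.infDist_le_dist_of_mem hd₀).trans ?_
      have := (pi_norm_le_iff_of_nonneg zero_le_one).2 hd₀.1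
      linarith [dist_le_norm_add_norm x d₀]
    rw [← lt_sub_iff_add_lt', ← Real.lt_toNNReal_iff_coe_lt, Formula.infs_lt_iff] at hlt
    obtain ⟨y, hy, hyr⟩ := hlt
    simp only [Formula.eval, ContinuousMap.coe_mk, hψ', Term.eval_var, Fin.append_right,
      max_lt_iff, Real.lt_toNNReal_iff_coe_lt, NNReal.coe_mul, hc, hχ] at hyr
    have hyδ : (ψ.eval y : ℝ) < δ := by
      have h3 := hyr.1
      rw [div_mul_eq_mul_div, div_lt_iff₀ hδ] at h3
      nlinarith
    obtain ⟨z, hz, hyz⟩ := hnear x y hx1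
      ((pi_norm_le_iff_of_nonneg (Nat.cast_nonneg K)).2 hy) hyδ
    rw [NNReal.dist_eq, hχ, hχ, abs_sub_lt_iff] at hyz
    obtain ⟨d, hd, hzd⟩ := H.exists_realization_near hM
      ((hψ.sameType_of_elementarilyEquivalent hM hz).eval_terms t) hte
    have := Metric.infDist_le_dist_of_mem (x := x) ((mem_realizations_tp_iff ha).2 hd)
    linarith [dist_triangle x (fun i => (t i).eval z) d, hyz.2, hyr.2]

theorem ApproximatedByIsolated.isPrincipal {a : Fin m → A} (H : ApproximatedByIsolated a)
    (ha : a ∈ unitBallTuples A m) : IsPrincipal A (tp a) := by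
  intro M _ hM
  have hD : (realizations (tp a) M).Nonempty := by
    obtain ⟨k, ψ, e, t, hψ, hte⟩ := H 1 one_pos
    obtain ⟨z, hz⟩ := hψ.exists_zero hM
    obtain ⟨d, hd, -⟩ := H.exists_realization_near hM
      ((hψ.sameType_of_elementarilyEquivalent hM hz).eval_terms t) hte
    exact ⟨d, (mem_realizations_tp_iff ha).2 hd⟩
  refine ⟨hD, ?_, fun w hw => hw.1, ?_⟩
  · have : realizations (tp a) M = ⋂ φ : Formula m, {w : Fin m → M | φ.eval a = φ.eval w} := by
      ext w
      simp [mem_realizations_tp_iff ha, SameType]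
    rw [this]
    exact isClosed_iInter fun φ => isClosed_eq continuous_const φ.continuous
  · choose φ hφ using fun N : ℕ => H.exists_formula_infDist ha hM hD
      (show (0 : ℝ) < 1 / ((N : ℝ) + 1) by positivity)
    refine ⟨φ, Metric.tendstoUniformlyOn_iff.2 fun ε hε => ?_⟩
    have hlim := (tendsto_one_div_add_atTop_nhds_zero_nat (𝕜 := ℝ)).const_mul 6
    rw [mul_zero] at hlim
    filter_upwards [hlim.eventually_lt_const hε] with N hN x hx
    rw [dist_comm, Real.dist_eq]
    exact (hφ N x hx).trans_lt hN

end Types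

/-! ### Isolated generators and approximation in the direct limit -/

section DirectLimit

variable {A : Type u} [CStarAlgebra A] {m k : ℕ}

/-- Conjugacy enters here: an automorphism of `A` carries the given tuple to any other zero, and
automorphisms preserve formulas. Zeros are bounded because *-homomorphisms are contractive. -/
theorem Formula.Defines.isolates {C : Type u} [CStarAlgebra C] {g : Fin k → C} {ψ : Formula k}
    (hdef : ψ.Defines g) (hψ : Formula.IsStable.{u} ψ) (hconj : UnitalCopiesConjugate C A)
    {ι : C →⋆ₐ[ℂ] A} (hι : Function.Injective ι) : ψ.Isolates fun i => ι (g i) where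
  stable := hψ
  bounded := by
    obtain ⟨K, hK⟩ := exists_nat_ge ‖g‖
    refine ⟨K, fun B _ b hb => ?_⟩
    obtain ⟨Φ, -, hΦ⟩ := (hdef B b).1 hb
    refine (pi_norm_le_iff_of_nonneg (Nat.cast_nonneg K)).2 fun i => ?_
    rw [← hΦ]
    exact (NonUnitalStarAlgHom.norm_apply_le Φ (g i)).trans ((norm_le_pi_norm g i).trans hK)
  zero := (hdef A _).2 ⟨ι, hι, fun _ => rfl⟩
  sameType z hz φ := by
    obtain ⟨Φ, hΦ, hg⟩ := (hdef A z).1 hz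
    obtain ⟨σ, hσ⟩ := hconj ι Φ hι hΦ
    have : z = fun i => σ (ι (g i)) := funext fun i => by rw [hσ, hg]
    rw [this, φ.eval_equiv]

/-- The ranges increase, so one stage serves all the finitely many coordinates. -/
theorem IsDirectLimit.exists_near {C : ℕ → Type u} [∀ n, CStarAlgebra (C n)]
    {j : ∀ n, C n →⋆ₐ[ℂ] C (n + 1)} {ι : ∀ n, C n →⋆ₐ[ℂ] A} (hlim : IsDirectLimit C j ι)
    (a : Fin m → A) {ε : ℝ} (hε : 0 < ε) :
    ∃ (n : ℕ) (c : Fin m → C n), ∀ i, dist (ι n (c i)) (a i) < ε := by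
  have hmono : Monotone fun n => Set.range (ι n) := monotone_nat_of_le_succ fun n => by
    rintro _ ⟨x, rfl⟩
    exact ⟨j n x, hlim.compatible n x⟩
  have h : ∀ i, ∃ n, ∃ b ∈ Set.range (ι n), dist b (a i) < ε := fun i => by
    obtain ⟨b, hb, hd⟩ := Metric.dense_iff.1 hlim.dense (a i) ε hε
    obtain ⟨n, hn⟩ := Set.mem_iUnion.1 hd
    exact ⟨n, b, hn, hb⟩
  choose n b hb hd using h
  choose c hc using fun i => hmono (Finset.le_sup (f := n) (Finset.mem_univ i)) (hb i)
  exact ⟨Finset.univ.sup n, c, fun i => by rw [hc]; exact hd i⟩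

theorem IsDirectLimit.approximatedByIsolated {C : ℕ → Type u} [∀ n, CStarAlgebra (C n)]
    {j : ∀ n, C n →⋆ₐ[ℂ] C (n + 1)} {ι : ∀ n, C n →⋆ₐ[ℂ] A} (hlim : IsDirectLimit C j ι)
    (hgen : ∀ n, HasStableQFGenerators (C n)) (hconj : ∀ n, UnitalCopiesConjugate (C n) A)
    (a : Fin m → A) : ApproximatedByIsolated a := by
  intro ε hε
  obtain ⟨n, c, hc⟩ := hlim.exists_near a (half_pos hε)
  obtain ⟨k, g, ψ, hdense, -, hstable, hdef⟩ := hgen n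
  choose b hb hbmem using fun i => Metric.dense_iff.1 hdense (c i) (ε / 2) (half_pos hε)
  choose t ht using fun i => Term.exists_eval_eq_of_mem_adjoin g (hbmem i)
  refine ⟨k, ψ, _, t, hdef.isolates hstable (hconj n) (hlim.injective n), ?_⟩
  rw [dist_pi_lt_iff hε]
  intro i
  have hle : dist (ι n (b i)) (ι n (c i)) ≤ dist (b i) (c i) := by
    rw [dist_eq_norm, dist_eq_norm, ← map_sub]
    exact NonUnitalStarAlgHom.norm_apply_le (ι n) _
  rw [Term.eval_map, ht]
  linarith [dist_triangle (ι n (b i)) (ι n (c i)) (a i), hc i, Metric.mem_ball.1 (hb i)]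

end DirectLimit

end CStarLogic

theorem propositionP {A : Type u} [CStarAlgebra A] [TopologicalSpace.SeparableSpace A]
    (C : ℕ → Type u) [∀ n, CStarAlgebra (C n)]
    (j : ∀ n, C n →⋆ₐ[ℂ] C (n + 1)) (ι : ∀ n, C n →⋆ₐ[ℂ] A)
    (hlim : CStarLogic.IsDirectLimit C j ι)
    (hgen : ∀ n, CStarLogic.HasStableQFGenerators (C n))
    (hconj : ∀ n, CStarLogic.UnitalCopiesConjugate (C n) A) :
    CStarLogic.IsAtomic A := by
  intro n a ha
  exact (hlim.approximatedByIsolated hgen hconj a).isPrincipal ha
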